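/- Let $n\ge 1$ be an integer and $0<s<1$. For $t>0$, $\lambda\in\mathbb R$ and $z\in\mathbb C^n$ (with Euclidean norm $|z|$) let $$q_t^\lambda(z)=(4\pi)^{-n}\Big(\frac{\lambda}{\sinh t\lambda}\Big)^n e^{-\frac14\lambda(\coth t\lambda)|z|^2}$$ (the heat kernel of the sublaplacian of the Heisenberg group $\mathbb H^n=\mathbb C^n\times\mathbb R$, Fourier transformed in the central variable), where at $\lambda=0$ every expression stands for its limit. Let the modified heat kernel $\mathcal K_t^s$ on $\mathbb H^n$ be the inverse Fourier transform $$\mathcal K_t^s(z,w)=\frac1{2\pi}\int_{-\infty}^\infty e^{-i\lambda w}\,q_t^\lambda(z)\Big(\frac{\lambda t}{\sinh\lambda t}\Big)^{s+1}d\lambda .$$ Let $Q=2n+2$ be the homogeneous dimension, $|(z,w)|=(|z|^4+16w^2)^{1/4}$ the homogeneous norm, and $$\mathcal K_s(z,w)=\int_0^\infty \mathcal K_t^s(z,w)\,t^{-s-1}\,dt .$$ (i) For all $t>0$ and $z\in\mathbb C^n$ the function $w\mapsto\mathcal K_t^s(z,w)$ is continuous and integrable on $\mathbb R$, and it satisfies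 the defining equation $$\int_{-\infty}^\infty\mathcal K_t^s(z,w)e^{i\lambda w}\,dw=q_t^\lambda(z)\Big(\frac{\lambda t}{\sinh\lambda t}\Big)^{s+1}\qquad(\lambda\in\mathbb R).$$ (ii) For every $(z,w)\in\mathbb H^n\setminus\{(0,0)\}$ the integral defining $\mathcal K_s(z,w)$ converges absolutely, and $$\mathcal K_s(z,w)=2^{\,n+1+3s}\,\pi^{-n-1}\,\Gamma\Big(\frac{n+s+1}{2}\Big)^2\,|(z,w)|^{-Q-2s}.$$ -/

import Mathlib

open Real MeasureTheory Set

noncomputable section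

/-- The underlying set `ℂⁿ × ℝ` of the Heisenberg group, with Euclidean norm on `ℂⁿ`. -/
abbrev HeisenbergSpace (n : ℕ) : Type := EuclideanSpace ℂ (Fin n) × ℝ

/-- The homogeneous dimension `Q = 2(n+1)`. -/
def homogeneousDim (n : ℕ) : ℝ := 2 * ((n : ℝ) + 1)

/-- The homogeneous norm `|(z,w)| = (|z|⁴ + 16 w²)^{1/4}`. -/
def homogeneousNorm {n : ℕ} (x : HeisenbergSpace n) : ℝ :=
  (‖x.1‖ ^ 4 + 16 * x.2 ^ 2) ^ ((1 : ℝ) / 4)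

/-- `l / sinh (t l)`, with its limit `1 / t` at `l = 0`. -/
def overSinh (t l : ℝ) : ℝ := if l = 0 then 1 / t else l / sinh (t * l)

/-- The heat kernel on the partial Fourier transform side,
`q_t^l(z) = (4π)^{-n} (l / sinh (t l))^n exp (-(1/4) l coth (t l) |z|²)`,
with its limit `(4πt)^{-n} exp (-|z|²/(4t))` at `l = 0`. -/
def heatKernelFT {n : ℕ} (t l : ℝ) (z : EuclideanSpace ℂ (Fin n)) : ℝ :=
  ((4 * π) ^ n)⁻¹ * overSinh t l ^ n *
    Real.exp (-(1 / 4) * (overSinh t l * cosh (t * l)) * ‖z‖ ^ 2)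

/-- `q_t^l(z) (l t / sinh (l t))^{s+1}`. -/
def modifiedHeatKernelFT {n : ℕ} (s t l : ℝ) (z : EuclideanSpace ℂ (Fin n)) : ℝ :=
  heatKernelFT t l z * (t * overSinh t l) ^ (s + 1)

/-- The modified heat kernel: the function of `(z,w)` with
`∫ 𝓚_t^s(z,w) e^{ilw} dw = q_t^l(z) (l t / sinh (l t))^{s+1}`, given by the inversion formula
`(1/2π) ∫ e^{-ilw} q_t^l(z) (l t / sinh (l t))^{s+1} dl`. -/
def modifiedHeatKernel {n : ℕ} (s t : ℝ) (x : HeisenbergSpace n) : ℂ :=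
  1 / (2 * (π : ℂ)) * ∫ l : ℝ,
    Complex.exp (-(Complex.I * (l : ℂ) * (x.2 : ℂ))) * (modifiedHeatKernelFT s t l x.1 : ℂ)

/-- `𝓚_s(z,w) = ∫_0^∞ 𝓚_t^s(z,w) t^{-s-1} dt`. -/
def fractionalKernel {n : ℕ} (s : ℝ) (x : HeisenbergSpace n) : ℂ :=
  ∫ t in Ioi (0 : ℝ), modifiedHeatKernel s t x * ((t ^ (-s - 1) : ℝ) : ℂ)

end

open Filter Topology

/-! Put `a = n + s + 1`, `r = |z|²` and `S(u) = u / sinh u`. After rescaling the frequency to `u =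
tλ`, the kernel at time `t` is a constant times `t ^ (-n-1)` times the integral over real `u` of `S
^ a * exp (-S (r cosh u + 4iw sinh u) / (4t))`. With `ζ = r + 4iw = R e^{iθ}`, the bracket equals `R
cosh (u + iθ)`. Since `r ≥ 0`, `|θ| ≤ π/2`, and on the closed strip `|Im u| ≤ π/2` the function `S`
is holomorphic with positive real part and exponential decay. So the contour may be moved to `u = x
- iθ`, where the bracket is the positive real `R cosh x`. Integrating in `t` first, the Laplace
integral gives `Γ(a) S ^ (-a) (R cosh x / 4) ^ (-a)`, whose power of `S` cancels `S ^ a`. What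
remains is `∫ cosh ^ (-a)`, a beta integral whose denominator `Γ(a)` also cancels, and `R` is the
square of the homogeneous norm. For (i), moving the contour to the edge of the strip on the side set
by the sign of `w` gives exponential decay in `w`, hence integrability; Fourier inversion then
applies. -/

/-! ### Contour shifts in a horizontal strip -/

theorem integrable_exp_neg_mul_abs {k : ℝ} (hk : 0 < k) :
    Integrable fun x : ℝ => Real.exp (-(k * |x|)) := by
  rw [← integrableOn_univ, ← Iic_union_Ioi (a := (0 : ℝ)), integrableOn_union]
  constructor
  · refine (integrableOn_exp_mul_Iic hk 0).congr_fun (fun x hx => ?_) measurableSet_Iic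
    simp only [abs_of_nonpos (mem_Iic.1 hx), mul_neg, neg_neg]
  · refine (integrableOn_exp_mul_Ioi (neg_neg_of_pos hk) 0).congr_fun (fun x hx => ?_)
      measurableSet_Ioi
    simp only [abs_of_pos (mem_Ioi.1 hx), neg_mul]

/-- Integrability along a horizontal line of a strip. -/
theorem integrable_horizontal {f : ℂ → ℂ} {c C k y : ℝ} (hk : 0 < k) (hy : |y| ≤ c)
    (hf : ∀ u : ℂ, |u.im| ≤ c → DifferentiableAt ℂ f u)
    (hb : ∀ u : ℂ, |u.im| ≤ c → ‖f u‖ ≤ C * Real.exp (-(k * |u.re|))) :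
    Integrable fun x : ℝ => f (x + y * Complex.I) := by
  refine ((integrable_exp_neg_mul_abs hk).const_mul C).mono' ?_ ?_
  · refine Continuous.aestronglyMeasurable (continuous_iff_continuousAt.2 fun x => ?_)
    exact ContinuousAt.comp (f := fun x : ℝ => (x : ℂ) + y * Complex.I)
      (hf _ (by simpa using hy)).continuousAt (by fun_prop)
  · exact Eventually.of_forall fun x => by simpa using hb (x + y * Complex.I) (by simpa using hy)

/-- Shifting the contour of integration inside a horizontal strip. -/
theorem integral_horizontal_eq {f : ℂ → ℂ} {c C k y : ℝ} (hk : 0 < k) (hy : |y| ≤ c)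
    (hf : ∀ u : ℂ, |u.im| ≤ c → DifferentiableAt ℂ f u)
    (hb : ∀ u : ℂ, |u.im| ≤ c → ‖f u‖ ≤ C * Real.exp (-(k * |u.re|))) :
    ∫ x : ℝ, f x = ∫ x : ℝ, f (x + y * Complex.I) := by
  have hc : 0 ≤ c := (abs_nonneg y).trans hy
  have i0 : Integrable fun x : ℝ => f x := by
    simpa using integrable_horizontal hk (y := 0) (by simpa using hc) hf hb
  have i1 := integrable_horizontal hk hy hf hb
  have hyc : ∀ τ ∈ uIoc (0 : ℝ) y, |τ| ≤ c := by
    intro τ hτ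
    refine le_trans ?_ hy
    rcases mem_uIoc.1 hτ with h | h
    · rw [abs_of_pos h.1]; exact h.2.trans (le_abs_self y)
    · rw [abs_of_nonpos h.2]; exact (neg_le_neg h.1.le).trans (neg_le_abs y)
  -- The vertical sides of the rectangle, at real part `±T`, contribute nothing in the limit.
  have vert : ∀ ε : ℝ, |ε| = 1 → Tendsto (fun T : ℝ => ∫ τ : ℝ in (0 : ℝ)..y,
      f ((ε * T : ℝ) + τ * Complex.I)) atTop (𝓝 0) := by
    intro ε hε
    have h0 : Tendsto (fun T : ℝ => C * Real.exp (-(k * T)) * |y - 0|) atTop (𝓝 0) := by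
      have : Tendsto (fun T : ℝ => Real.exp (-(k * T))) atTop (𝓝 0) :=
        Real.tendsto_exp_neg_atTop_nhds_zero.comp (tendsto_id.const_mul_atTop hk)
      simpa using (this.const_mul C).mul_const |y - 0|
    refine squeeze_zero_norm' ?_ h0
    filter_upwards [eventually_ge_atTop 0] with T hT
    refine intervalIntegral.norm_integral_le_of_norm_le_const fun τ hτ => ?_
    have := hb ((ε * T : ℝ) + τ * Complex.I) (by simpa using hyc τ hτ)
    simpa [abs_mul, hε, abs_of_nonneg hT] using this
  have rect : ∀ T : ℝ, ∫ x : ℝ in -T..T, f x = (∫ x : ℝ in -T..T, f (x + y * Complex.I))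
      - Complex.I * (∫ τ : ℝ in (0 : ℝ)..y, f ((1 * T : ℝ) + τ * Complex.I))
      + Complex.I * (∫ τ : ℝ in (0 : ℝ)..y, f ((-1 * T : ℝ) + τ * Complex.I)) := by
    intro T
    have := Complex.integral_boundary_rect_eq_zero_of_differentiableOn f (-T) (T + y * Complex.I)
      (fun u hu => by
        refine (hf u ?_).differentiableWithinAt
        have := hu.2
        simp only [mem_preimage, Complex.neg_im, Complex.ofReal_im, neg_zero, Complex.add_im,
          Complex.mul_im, Complex.ofReal_re, Complex.I_im, mul_one, Complex.I_re, mul_zero,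
          add_zero, zero_add] at this
        refine le_trans ?_ hy
        simpa using abs_sub_left_of_mem_uIcc this)
    simp only [Complex.neg_im, Complex.ofReal_im, neg_zero, Complex.ofReal_zero, zero_mul, add_zero,
      Complex.neg_re, Complex.ofReal_re, Complex.add_re, Complex.mul_re, Complex.I_re, mul_zero,
      Complex.I_im, sub_zero, Complex.add_im, Complex.mul_im, mul_one, zero_add, smul_eq_mul,
      Complex.ofReal_neg] at this
    simp only [one_mul, neg_mul, Complex.ofReal_neg]
    linear_combination this
  have l0 := intervalIntegral_tendsto_integral i0 tendsto_neg_atTop_atBot tendsto_id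
  have l1 := intervalIntegral_tendsto_integral i1 tendsto_neg_atTop_atBot tendsto_id
  refine tendsto_nhds_unique l0 ?_
  simp only [id, rect]
  simpa using (l1.sub ((vert 1 (by simp)).const_mul Complex.I)).add
    ((vert (-1) (by simp)).const_mul Complex.I)

/-! ### Laplace and beta integrals -/

/-- The Laplace transform of `x ^ (a - 1)` on the open right half-plane. -/
theorem integral_rpow_mul_cexp_neg_mul_Ioi {a : ℝ} (ha : 0 < a) {B : ℂ} (hB : 0 < B.re) :
    ∫ x : ℝ in Ioi 0, ((x ^ (a - 1) : ℝ) : ℂ) * Complex.exp (-(B * x)) =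
      Real.Gamma a * (B⁻¹) ^ (a : ℂ) := by
  have hopen : IsOpen {z : ℂ | 0 < z.re} := isOpen_lt continuous_const Complex.continuous_re
  have hint : ∀ (b ε : ℝ), 0 < b → 0 < ε →
      IntegrableOn (fun x : ℝ => x ^ (b - 1) * Real.exp (-ε * x)) (Ioi 0) := fun b ε hb hε => by
    simpa using integrableOn_rpow_mul_exp_neg_mul_rpow (s := b - 1) (p := 1) (b := ε)
      (by linarith) one_pos hε
  have hmeas : ∀ (b : ℝ) (z : ℂ), AEStronglyMeasurable
      (fun x : ℝ => ((x ^ b : ℝ) : ℂ) * Complex.exp (-(z * x))) (volume.restrict (Ioi 0)) :=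
    fun b z => by
      refine Measurable.aestronglyMeasurable ?_
      fun_prop
  have hdiff : DifferentiableOn ℂ (fun z : ℂ => ∫ x : ℝ in Ioi 0,
      ((x ^ (a - 1) : ℝ) : ℂ) * Complex.exp (-(z * x))) {z | 0 < z.re} := by
    intro z hz
    have hz : 0 < z.re := hz
    have hnhds : {u : ℂ | z.re / 2 < u.re} ∈ 𝓝 z :=
      (isOpen_lt continuous_const Complex.continuous_re).mem_nhds
        (by simp only [mem_ofPred_eq]; linarith)
    refine (hasDerivAt_integral_of_dominated_loc_of_deriv_le
      (F' := fun (u : ℂ) (x : ℝ) => -(((x ^ a : ℝ) : ℂ) * Complex.exp (-(u * x))))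
      -- Differentiating brings down a factor `x`; restricting to `Re u > Re z / 2` makes the decay
      -- rate uniform near `z`.
      (bound := fun x : ℝ => x ^ ((a + 1) - 1) * Real.exp (-(z.re / 2) * x))
      hnhds (Eventually.of_forall fun u => hmeas _ u) ?_ (hmeas _ z).neg ?_
      (hint _ _ (by linarith) (by linarith)) ?_).2.differentiableAt.differentiableWithinAt
    · refine (hint a z.re ha hz).mono' (hmeas _ z) ?_
      filter_upwards [ae_restrict_mem measurableSet_Ioi] with x hx
      have hx : 0 < x := hx
      simp [Complex.norm_exp, abs_of_nonneg (rpow_nonneg hx.le _)]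
    · filter_upwards [ae_restrict_mem measurableSet_Ioi] with x hx u hu
      have hx : 0 < x := hx
      have hu : z.re / 2 < u.re := hu
      simp only [norm_neg, norm_mul, Complex.norm_real, Real.norm_eq_abs,
        abs_of_nonneg (rpow_nonneg hx.le _), Complex.norm_exp, add_sub_cancel_right]
      gcongr
      simp only [Complex.neg_re, Complex.mul_re, Complex.ofReal_re, Complex.ofReal_im, mul_zero,
        sub_zero]
      nlinarith
    · filter_upwards [ae_restrict_mem measurableSet_Ioi] with x hx u hu
      have hx : 0 < x := hx
      have h1 : HasDerivAt (fun u : ℂ => Complex.exp (-(u * x)))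
          (Complex.exp (-(u * x)) * -(1 * x)) u :=
        ((hasDerivAt_id u).mul_const (x : ℂ)).neg.cexp
      convert! h1.const_mul ((x ^ (a - 1) : ℝ) : ℂ) using 1
      have : x ^ a = x ^ (a - 1) * x := by
        rw [← rpow_add_one hx.ne', sub_add_cancel]
      rw [this]; push_cast; ring
  have hdiff' : DifferentiableOn ℂ (fun z : ℂ => Real.Gamma a * (z⁻¹) ^ (a : ℂ))
      {z | 0 < z.re} := by
    intro z hz
    have hz : 0 < z.re := hz
    have hz0 : z ≠ 0 := fun h => by simp [h] at hz
    have : z⁻¹ ∈ Complex.slitPlane := Or.inl (by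
      rw [Complex.inv_re]; exact div_pos hz (Complex.normSq_pos.2 hz0))
    exact (((differentiableAt_inv hz0).cpow_const this).const_mul _).differentiableWithinAt
  -- Identity theorem: both sides are analytic on the half-plane and agree at the real points `1 +
  -- 1/(m+1)`, which accumulate at `1`.
  refine (hdiff.analyticOnNhd hopen).eqOn_of_preconnected_of_frequently_eq
    (hdiff'.analyticOnNhd hopen) (convex_halfSpace_re_gt 0).isPreconnected
    (z₀ := 1) (by simp) ?_ hB
  have hreal : ∀ r : ℝ, 0 < r → (∫ x : ℝ in Ioi 0, ((x ^ (a - 1) : ℝ) : ℂ) *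
      Complex.exp (-((r : ℂ) * x))) = Real.Gamma a * ((r : ℂ)⁻¹) ^ (a : ℂ) := by
    intro r hr
    have := Complex.integral_cpow_mul_exp_neg_mul_Ioi (a := a) (r := r) (by simpa using ha) hr
    rw [Complex.Gamma_ofReal, one_div, mul_comm] at this
    rw [← this]
    refine setIntegral_congr_fun measurableSet_Ioi fun x hx => ?_
    have hx : 0 < x := hx
    simp [Complex.ofReal_cpow hx.le]
  have hseq : Tendsto (fun m : ℕ => ((1 + 1 / ((m : ℝ) + 1) : ℝ) : ℂ)) atTop (𝓝[≠] 1) := by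
    refine tendsto_nhdsWithin_iff.2 ⟨?_, Eventually.of_forall fun m => ?_⟩
    · have := (tendsto_one_div_add_atTop_nhds_zero_nat (𝕜 := ℝ)).const_add 1
      have := (Complex.continuous_ofReal.tendsto _).comp this
      simpa [Function.comp_def] using this
    · have : (0 : ℝ) < 1 / ((m : ℝ) + 1) := by positivity
      simp only [mem_compl_iff, mem_singleton_iff]
      rw [← Complex.ofReal_one, Complex.ofReal_inj]
      linarith
  exact hseq.frequently (Frequently.of_forall fun m => hreal _ (by positivity))

theorem integral_rpow_mul_cexp_neg_div_Ioi {a : ℝ} (ha : 0 < a) {B : ℂ} (hB : 0 < B.re) :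
    ∫ x : ℝ in Ioi 0, ((x ^ (-a - 1) : ℝ) : ℂ) * Complex.exp (-(B / x)) =
      Real.Gamma a * (B⁻¹) ^ (a : ℂ) := by
  rw [← integral_rpow_mul_cexp_neg_mul_Ioi ha hB, ← integral_comp_rpow_Ioi
    (fun x : ℝ => ((x ^ (a - 1) : ℝ) : ℂ) * Complex.exp (-(B * x))) (p := -1) (by norm_num)]
  refine setIntegral_congr_fun measurableSet_Ioi fun x hx => ?_
  have hx : 0 < x := hx
  have h : x ^ (-a - 1) = x ^ ((-1 : ℝ) - 1) * (x ^ (-1 : ℝ)) ^ (a - 1) := by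
    rw [← rpow_mul hx.le, ← rpow_add hx]; congr 1; ring
  simp only [abs_neg, abs_one, one_mul, h, Complex.real_smul, Complex.ofReal_mul, mul_assoc]
  rw [rpow_neg_one x]; simp [div_eq_mul_inv]

theorem integrableOn_rpow_mul_exp_neg_div_Ioi {a b : ℝ} (ha : 0 < a) (hb : 0 < b) :
    IntegrableOn (fun x : ℝ => x ^ (-a - 1) * Real.exp (-(b / x))) (Ioi 0) := by
  have h1 : IntegrableOn (fun x : ℝ => x ^ (a - 1) * Real.exp (-b * x)) (Ioi 0) := by
    simpa using integrableOn_rpow_mul_exp_neg_mul_rpow (s := a - 1) (p := 1) (b := b)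
      (by linarith) one_pos hb
  have h2 := (integrableOn_Ioi_comp_rpow_iff
    (fun x : ℝ => x ^ (a - 1) * Real.exp (-b * x)) (p := -1) (by norm_num)).2 h1
  refine h2.congr_fun (fun x hx => ?_) measurableSet_Ioi
  have hx : 0 < x := hx
  have h : x ^ (-a - 1) = x ^ ((-1 : ℝ) - 1) * (x ^ (-1 : ℝ)) ^ (a - 1) := by
    rw [← rpow_mul hx.le, ← rpow_add hx]; congr 1; ring
  simp only [abs_neg, abs_one, one_mul, h, smul_eq_mul, mul_assoc]
  rw [rpow_neg_one x]; simp [div_eq_mul_inv]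

/-- The substitution `p = sigmoid (2x)` turns the beta integral `B(a/2, a/2)` into this one, because
`p (1 - p) = (2 cosh x) ^ (-2)`. -/
theorem integral_cosh_rpow_neg {a : ℝ} (ha : 0 < a) :
    ∫ x : ℝ, cosh x ^ (-a) = 2 ^ (a - 1) * Real.Gamma (a / 2) ^ 2 / Real.Gamma a := by
  have ha2 : 0 < a / 2 := by linarith
  have hB := Complex.Gamma_mul_Gamma_eq_betaIntegral (s := (a / 2 : ℝ)) (t := (a / 2 : ℝ))
    (by simpa using ha) (by simpa using ha)
  have hbeta : Complex.betaIntegral (a / 2 : ℝ) (a / 2 : ℝ) =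
      ((∫ x in Ioo (0 : ℝ) 1, x ^ (a / 2 - 1) * (1 - x) ^ (a / 2 - 1) : ℝ) : ℂ) := by
    rw [Complex.betaIntegral, intervalIntegral.integral_of_le zero_le_one,
      integral_Ioc_eq_integral_Ioo, ← integral_complex_ofReal]
    refine setIntegral_congr_fun measurableSet_Ioo fun x hx => ?_
    have h1 : (0 : ℝ) ≤ 1 - x := by linarith [hx.2]
    push_cast [Complex.ofReal_cpow hx.1.le, Complex.ofReal_cpow h1]
    rfl
  have hd : ∀ x : ℝ, HasDerivAt (fun x => Real.sigmoid (2 * x))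
      (Real.sigmoid (2 * x) * (1 - Real.sigmoid (2 * x)) * (2 * 1)) x := fun x =>
    (Real.hasDerivAt_sigmoid (2 * x)).comp x ((hasDerivAt_id x).const_mul 2)
  have himage : (fun x : ℝ => Real.sigmoid (2 * x)) '' univ = Ioo 0 1 := by
    rw [image_univ, ← Real.range_sigmoid]
    exact (mul_left_surjective₀ (two_ne_zero (α := ℝ))).range_comp Real.sigmoid
  have hsub : ∫ x in Ioo (0 : ℝ) 1, x ^ (a / 2 - 1) * (1 - x) ^ (a / 2 - 1) =
      2 ^ (1 - a) * ∫ x : ℝ, cosh x ^ (-a) := by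
    rw [← himage, integral_image_eq_integral_abs_deriv_smul MeasurableSet.univ
      (fun x _ => (hd x).hasDerivWithinAt) (fun x _ y _ h => by
        have := Real.sigmoid_injective h
        linarith), setIntegral_univ, ← integral_const_mul]
    congr 1
    ext x
    have e1 : Real.sigmoid (2 * x) * (1 - Real.sigmoid (2 * x)) = ((2 * cosh x) ^ 2)⁻¹ := by
      rw [← Real.sigmoid_neg, Real.sigmoid_def, Real.sigmoid_def, ← mul_inv, Real.cosh_eq, neg_neg]
      congr 1
      have h2 : Real.exp (2 * x) = Real.exp x ^ 2 := by rw [← Real.exp_nat_mul]; norm_num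
      have h3 : Real.exp (-(2 * x)) = Real.exp (-x) ^ 2 := by
        rw [← Real.exp_nat_mul]; congr 1; push_cast; ring
      have h4 : Real.exp x * Real.exp (-x) = 1 := by rw [← Real.exp_add]; simp
      rw [h2, h3]
      linear_combination (Real.exp x * Real.exp (-x) - 1) * h4
    have hp := Real.sigmoid_pos (2 * x)
    have hq : 0 < 1 - Real.sigmoid (2 * x) := by linarith [Real.sigmoid_lt_one (2 * x)]
    have hc := Real.cosh_pos x
    rw [smul_eq_mul, ← mul_rpow hp.le hq.le, abs_of_pos (by positivity), e1,
      ← rpow_natCast, ← rpow_neg (by positivity), ← rpow_mul (by positivity)]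
    rw [mul_one, mul_right_comm, ← rpow_add (by positivity), mul_rpow (by norm_num) hc.le]
    have e2 : -((2 : ℕ) : ℝ) + -((2 : ℕ) : ℝ) * (a / 2 - 1) = -a := by push_cast; ring
    have e3 : (2 : ℝ) ^ (1 - a) = 2 * 2 ^ (-a) := by
      rw [sub_eq_add_neg, rpow_add two_pos, rpow_one]
    rw [e2, e3]
    ring
  rw [hbeta, hsub, ← Complex.ofReal_add, Complex.Gamma_ofReal, Complex.Gamma_ofReal,
    add_halves] at hB
  have hB' : Real.Gamma (a / 2) * Real.Gamma (a / 2) =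
    Real.Gamma a * (2 ^ (1 - a) * ∫ x : ℝ, cosh x ^ (-a)) := by exact_mod_cast hB
  have h2 : (2 : ℝ) ^ (a - 1) * 2 ^ (1 - a) = 1 := by
    rw [← rpow_add two_pos]; simp
  rw [eq_div_iff (Real.Gamma_pos_of_pos ha).ne', sq, hB']
  linear_combination (-(Real.Gamma a * ∫ x : ℝ, cosh x ^ (-a))) * h2

/-! ### The function `u / sinh u` on the strip `|Im u| ≤ π/2` -/

theorem self_mul_sinh_nonneg (x : ℝ) : 0 ≤ x * sinh x := by
  rcases le_total 0 x with h | h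
  · exact mul_nonneg h (sinh_nonneg_iff.2 h)
  · exact mul_nonneg_of_nonpos_of_nonpos h (sinh_nonpos_iff.2 h)

theorem sq_le_sinh_sq (x : ℝ) : x ^ 2 ≤ sinh x ^ 2 := by
  rw [sq_le_sq]
  rcases le_total 0 x with h | h
  · rw [abs_of_nonneg h, abs_of_nonneg (sinh_nonneg_iff.2 h)]; exact self_le_sinh_iff.2 h
  · rw [abs_of_nonpos h, abs_of_nonpos (sinh_nonpos_iff.2 h)]
    exact neg_le_neg (sinh_le_self_iff.2 h)

theorem sinh_sq_le_self_mul_sinh_mul_cosh (x : ℝ) : sinh x ^ 2 ≤ x * sinh x * cosh x := by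
  have key : ∀ x : ℝ, 0 ≤ x → sinh x ≤ x * cosh x := by
    have hd : ∀ x : ℝ, HasDerivAt (fun x => x * cosh x - sinh x) (x * sinh x) x := fun x => by
      convert! ((hasDerivAt_id x).mul (Real.hasDerivAt_cosh x)).sub (Real.hasDerivAt_sinh x) using 1
      simp
    have hm : Monotone fun x : ℝ => x * cosh x - sinh x :=
      monotone_of_hasDerivAt_nonneg hd fun x => self_mul_sinh_nonneg x
    intro x hx
    have := hm hx
    simp only [zero_mul, sinh_zero, sub_zero] at this
    linarith
  rcases le_total 0 x with h | h
  · nlinarith [key x h, sinh_nonneg_iff.2 h]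
  · have h1 := key (-x) (by linarith)
    rw [sinh_neg, cosh_neg] at h1
    nlinarith [sinh_nonpos_iff.2 h]

theorem self_mul_sin_nonneg {y : ℝ} (hy : |y| ≤ π / 2) : 0 ≤ y * sin y := by
  rcases le_total 0 y with h | h
  · exact mul_nonneg h (sin_nonneg_of_nonneg_of_le_pi h (by linarith [le_abs_self y, pi_pos]))
  · exact mul_nonneg_of_nonpos_of_nonpos h
      (sin_nonpos_of_nonpos_of_neg_pi_le h (by linarith [neg_abs_le y, pi_pos]))

theorem self_mul_sin_pos {y : ℝ} (hy : |y| ≤ π / 2) (h0 : y ≠ 0) : 0 < y * sin y := by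
  refine lt_of_le_of_ne (self_mul_sin_nonneg hy) (Ne.symm (mul_ne_zero h0 fun h => ?_))
  have := mul_abs_le_abs_sin hy
  rw [h, abs_zero] at this
  have : 0 < 2 / π * |y| := by positivity
  linarith

theorem cos_nonneg_of_abs_le {y : ℝ} (hy : |y| ≤ π / 2) : 0 ≤ cos y :=
  cos_nonneg_of_neg_pi_div_two_le_of_le (abs_le.1 hy).1 (abs_le.1 hy).2

namespace Complex

theorem sinh_re' (u : ℂ) : (Complex.sinh u).re = Real.sinh u.re * Real.cos u.im := by
  conv_lhs => rw [← Complex.re_add_im u]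
  rw [Complex.sinh_add, Complex.sinh_mul_I, Complex.cosh_mul_I, ← Complex.ofReal_sinh,
    ← Complex.ofReal_cosh, ← Complex.ofReal_sin, ← Complex.ofReal_cos]
  simp [-Complex.ofReal_sinh, -Complex.ofReal_cosh, -Complex.ofReal_sin, -Complex.ofReal_cos]

theorem sinh_im' (u : ℂ) : (Complex.sinh u).im = Real.cosh u.re * Real.sin u.im := by
  conv_lhs => rw [← Complex.re_add_im u]
  rw [Complex.sinh_add, Complex.sinh_mul_I, Complex.cosh_mul_I, ← Complex.ofReal_sinh,
    ← Complex.ofReal_cosh, ← Complex.ofReal_sin, ← Complex.ofReal_cos]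
  simp [-Complex.ofReal_sinh, -Complex.ofReal_cosh, -Complex.ofReal_sin, -Complex.ofReal_cos]

theorem cosh_re' (u : ℂ) : (Complex.cosh u).re = Real.cosh u.re * Real.cos u.im := by
  conv_lhs => rw [← Complex.re_add_im u]
  rw [Complex.cosh_add, Complex.sinh_mul_I, Complex.cosh_mul_I, ← Complex.ofReal_sinh,
    ← Complex.ofReal_cosh, ← Complex.ofReal_sin, ← Complex.ofReal_cos]
  simp [-Complex.ofReal_sinh, -Complex.ofReal_cosh, -Complex.ofReal_sin, -Complex.ofReal_cos]

theorem cosh_im' (u : ℂ) : (Complex.cosh u).im = Real.sinh u.re * Real.sin u.im := by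
  conv_lhs => rw [← Complex.re_add_im u]
  rw [Complex.cosh_add, Complex.sinh_mul_I, Complex.cosh_mul_I, ← Complex.ofReal_sinh,
    ← Complex.ofReal_cosh, ← Complex.ofReal_sin, ← Complex.ofReal_cos]
  simp [-Complex.ofReal_sinh, -Complex.ofReal_cosh, -Complex.ofReal_sin, -Complex.ofReal_cos]

theorem normSq_sinh (u : ℂ) :
    Complex.normSq (Complex.sinh u) = Real.sinh u.re ^ 2 + Real.sin u.im ^ 2 := by
  rw [Complex.normSq_apply, sinh_re', sinh_im']
  linear_combination (Real.sin u.im ^ 2) * Real.cosh_sq u.re +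
    (Real.sinh u.re ^ 2) * Real.sin_sq_add_cos_sq u.im

end Complex

/-- The entire extension of `u / sinh u` away from the nonzero multiples of `π i`. -/
noncomputable def overCsinh (u : ℂ) : ℂ := (dslope Complex.sinh 0 u)⁻¹

theorem overCsinh_zero : overCsinh 0 = 1 := by
  simp [overCsinh, dslope_same, Complex.deriv_sinh]

theorem overCsinh_of_ne {u : ℂ} (hu : u ≠ 0) : overCsinh u = u / Complex.sinh u := by
  simp [overCsinh, dslope_of_ne _ hu, slope_def_field]

/-- Here `|sinh u|² = sinh² (Re u) + sin² (Im u)`; the second term is controlled by Jordan's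
inequality, the source of the factor `π/2`. -/
theorem normSq_le_normSq_sinh {u : ℂ} (hu : |u.im| ≤ π / 2) :
    Complex.normSq u ≤ (π / 2) ^ 2 * Complex.normSq (Complex.sinh u) := by
  rw [Complex.normSq_sinh, Complex.normSq_apply, mul_add]
  have h1 := sq_le_sinh_sq u.re
  have h2 : |u.im| ≤ π / 2 * |sin u.im| := by
    have := mul_abs_le_abs_sin hu
    calc |u.im| = π / 2 * (2 / π * |u.im|) := by field_simp
      _ ≤ _ := by gcongr
  have h3 : u.im ^ 2 ≤ (π / 2) ^ 2 * sin u.im ^ 2 := by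
    rw [← sq_abs u.im, ← sq_abs (sin u.im), ← mul_pow]; gcongr
  have h4 : (1 : ℝ) ≤ (π / 2) ^ 2 := one_le_pow₀ (by linarith [pi_gt_three])
  nlinarith [sq_nonneg (sinh u.re)]

theorem Complex.sinh_ne_zero_of_abs_im_le {u : ℂ} (hu : |u.im| ≤ π / 2) (h0 : u ≠ 0) :
    Complex.sinh u ≠ 0 := fun h => by
  have := normSq_le_normSq_sinh hu
  rw [h, Complex.normSq_zero, mul_zero] at this
  exact this.not_gt (Complex.normSq_pos.2 h0)

theorem overCsinh_mul_sinh {u : ℂ} (hu : |u.im| ≤ π / 2) : overCsinh u * Complex.sinh u = u := by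
  rcases eq_or_ne u 0 with rfl | h0
  · simp
  · rw [overCsinh_of_ne h0, div_mul_cancel₀ _ (Complex.sinh_ne_zero_of_abs_im_le hu h0)]

theorem re_overCsinh_mul_normSq_sinh {u : ℂ} (hu : |u.im| ≤ π / 2) :
    (overCsinh u).re * Complex.normSq (Complex.sinh u) =
      u.re * sinh u.re * cos u.im + u.im * sin u.im * cosh u.re := by
  rcases eq_or_ne u 0 with rfl | h0
  · simp
  · have := Complex.normSq_pos.2 (Complex.sinh_ne_zero_of_abs_im_le hu h0)
    rw [overCsinh_of_ne h0, Complex.div_re, Complex.sinh_re', Complex.sinh_im']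
    field_simp

/-- Positivity keeps `u / sinh u` off the branch cut, so its principal power is holomorphic, and
makes the later Laplace integral in `t` converge. -/
theorem re_overCsinh_pos {u : ℂ} (hu : |u.im| ≤ π / 2) : 0 < (overCsinh u).re := by
  rcases eq_or_ne u 0 with rfl | h0
  · simp [overCsinh_zero]
  · have h1 := Complex.normSq_pos.2 (Complex.sinh_ne_zero_of_abs_im_le hu h0)
    refine pos_of_mul_pos_left ?_ h1.le
    rw [re_overCsinh_mul_normSq_sinh hu]
    have h2 := mul_nonneg (self_mul_sinh_nonneg u.re) (cos_nonneg_of_abs_le hu)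
    rcases eq_or_ne u.im 0 with hy | hy
    · have hx : u.re ≠ 0 := fun h => h0 (Complex.ext h hy)
      rw [hy]
      simp only [cos_zero, mul_one, zero_mul, add_zero]
      exact lt_of_le_of_ne (self_mul_sinh_nonneg _)
        (Ne.symm (mul_ne_zero hx (sinh_ne_zero.2 hx)))
    · have := mul_pos (self_mul_sin_pos hu hy) (cosh_pos u.re)
      linarith

theorem overCsinh_ne_zero {u : ℂ} (hu : |u.im| ≤ π / 2) : overCsinh u ≠ 0 := fun h => by
  simpa [h] using re_overCsinh_pos hu

theorem differentiableAt_overCsinh {u : ℂ} (hu : |u.im| ≤ π / 2) :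
    DifferentiableAt ℂ overCsinh u := by
  have h1 : DifferentiableOn ℂ (dslope Complex.sinh 0) univ :=
    (Complex.differentiableOn_dslope univ_mem).2 Complex.differentiable_sinh.differentiableOn
  exact (h1.differentiableAt univ_mem).inv fun h => overCsinh_ne_zero hu (by simp [overCsinh, h])

/-- With `x = Re u` and `S = u / sinh u`, write `cosh² x = sinh² x + 1`. Then `|S|² sinh² x ≤ |u|² ≤
x² + 4` and `|S|² ≤ 4`, so the square is at most `x² + 8 ≤ (|x| + 3)²`. -/
theorem norm_overCsinh_mul_cosh_le {u : ℂ} (hu : |u.im| ≤ π / 2) :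
    ‖overCsinh u‖ * cosh u.re ≤ |u.re| + 3 := by
  refine le_of_sq_le_sq ?_ (by positivity)
  have e : Complex.normSq (overCsinh u) * Complex.normSq (Complex.sinh u) = Complex.normSq u := by
    rw [← map_mul, overCsinh_mul_sinh hu]
  have h1 : Complex.normSq (overCsinh u) ≤ (π / 2) ^ 2 := by
    rcases eq_or_ne u 0 with rfl | h0
    · rw [overCsinh_zero, map_one]
      exact one_le_pow₀ (by linarith [pi_gt_three])
    · have := Complex.normSq_pos.2 (Complex.sinh_ne_zero_of_abs_im_le hu h0)
      have h2 := normSq_le_normSq_sinh hu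
      rw [← e] at h2
      exact le_of_mul_le_mul_right h2 this
  have h2 : u.im ^ 2 ≤ (π / 2) ^ 2 := by rw [← sq_abs]; gcongr
  rw [mul_pow, ← Complex.normSq_eq_norm_sq, Real.cosh_sq]
  rw [Complex.normSq_sinh, Complex.normSq_apply u] at e
  have h3 := mul_nonneg (Complex.normSq_nonneg (overCsinh u)) (sq_nonneg (sin u.im))
  have h4 : (π / 2) ^ 2 ≤ 4 := by nlinarith [pi_pos, pi_le_four]
  nlinarith [sq_abs u.re, abs_nonneg u.re]

theorem norm_overCsinh_le {u : ℂ} (hu : |u.im| ≤ π / 2) :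
    ‖overCsinh u‖ ≤ 12 * Real.exp (-(|u.re| / 2)) := by
  have h := norm_overCsinh_mul_cosh_le hu
  have h1 : Real.exp |u.re| / 2 ≤ cosh u.re := by
    rw [← cosh_abs, Real.cosh_eq]
    have := Real.exp_pos (-|u.re|)
    linarith
  have h2 : |u.re| + 3 ≤ 6 * Real.exp (|u.re| / 2) := by
    have := Real.add_one_le_exp (|u.re| / 2)
    linarith [abs_nonneg u.re]
  have h3 : Real.exp |u.re| = Real.exp (|u.re| / 2) * Real.exp (|u.re| / 2) := by
    rw [← Real.exp_add, add_halves]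
  have h4 := Real.exp_pos (|u.re| / 2)
  rw [Real.exp_neg, ← div_eq_mul_inv, le_div_iff₀ h4]
  have h5 : ‖overCsinh u‖ * (Real.exp |u.re| / 2) ≤ 6 * Real.exp (|u.re| / 2) :=
    (mul_le_mul_of_nonneg_left h1 (norm_nonneg _)).trans (h.trans h2)
  rw [h3] at h5
  refine le_of_mul_le_mul_right ?_ h4
  linarith

/-- For `u = x + iy`, the numerator of `Re (u coth u)` over `|sinh u|²` is `x sinh x cosh x + y sin
y cos y`. This keeps the factor carrying `|z|²` bounded by `1` on the whole strip. -/
theorem re_overCsinh_mul_cosh_nonneg {u : ℂ} (hu : |u.im| ≤ π / 2) :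
    0 ≤ (overCsinh u * Complex.cosh u).re := by
  rcases eq_or_ne u 0 with rfl | h0
  · simp [overCsinh_zero]
  · rw [overCsinh_of_ne h0, div_mul_eq_mul_div, Complex.div_re, ← add_div]
    refine div_nonneg ?_ (Complex.normSq_nonneg _)
    rw [Complex.mul_re, Complex.mul_im, Complex.sinh_re', Complex.sinh_im', Complex.cosh_re',
      Complex.cosh_im']
    have h1 := mul_nonneg (self_mul_sinh_nonneg u.re) (cosh_pos u.re).le
    have h2 := mul_nonneg (self_mul_sin_nonneg hu) (cos_nonneg_of_abs_le hu)
    have e : (u.re * (cosh u.re * cos u.im) - u.im * (sinh u.re * sin u.im)) *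
        (sinh u.re * cos u.im) + (u.re * (sinh u.re * sin u.im) + u.im * (cosh u.re * cos u.im)) *
        (cosh u.re * sin u.im) = u.re * sinh u.re * cosh u.re + u.im * sin u.im * cos u.im := by
      linear_combination (u.re * sinh u.re * cosh u.re) * Real.sin_sq_add_cos_sq u.im
        + (u.im * sin u.im * cos u.im) * Real.cosh_sq u.re
    rw [e]; linarith

/-- On each horizontal line of the strip, `Re (u / sinh u) * cosh (Re u)` is bounded below. -/
theorem exists_pos_le_re_overCsinh_mul_cosh {y : ℝ} (hy : |y| ≤ π / 2) :
    ∃ c > 0, ∀ x : ℝ, c ≤ (overCsinh (x + y * Complex.I)).re * cosh x := by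
  have key := fun x : ℝ => re_overCsinh_mul_normSq_sinh (u := x + y * Complex.I) (by simpa using hy)
  have pos := fun x : ℝ => re_overCsinh_pos (u := x + y * Complex.I) (by simpa using hy)
  simp only [Complex.normSq_sinh, Complex.add_re, Complex.ofReal_re, Complex.mul_re, Complex.I_re,
    mul_zero, Complex.ofReal_im, Complex.I_im, mul_one, sub_self, add_zero, Complex.add_im,
    Complex.mul_im, zero_add] at key
  -- For `y ≠ 0` the bound `y sin y` follows from `|sinh u|² ≤ cosh² x`. It degenerates at `y = 0`,
  -- where `sinh² x ≤ x sinh x cosh x` gives `1` instead.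
  rcases eq_or_ne y 0 with rfl | h0
  · refine ⟨1, one_pos, fun x => ?_⟩
    have k := key x
    simp only [sin_zero, cos_zero, mul_one, zero_mul, add_zero, ne_eq, OfNat.ofNat_ne_zero,
      not_false_eq_true, zero_pow] at k
    rcases eq_or_ne x 0 with rfl | hx
    · simp [overCsinh_zero]
    · have hs : 0 < sinh x ^ 2 := by have := sinh_ne_zero.2 hx; positivity
      refine le_of_mul_le_mul_right ?_ hs
      have := sinh_sq_le_self_mul_sinh_mul_cosh x
      rw [← k] at this
      linarith
  · refine ⟨y * sin y, self_mul_sin_pos hy h0, fun x => ?_⟩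
    have hc := cosh_pos x
    have h1 := mul_nonneg (self_mul_sinh_nonneg x) (cos_nonneg_of_abs_le hy)
    refine le_of_mul_le_mul_right ?_ hc
    have h2 : sinh x ^ 2 + sin y ^ 2 ≤ cosh x ^ 2 := by
      rw [Real.cosh_sq]; linarith [sin_sq_le_one y]
    have h3 := mul_le_mul_of_nonneg_left h2 (pos x).le
    have := key x
    nlinarith

/-! ### The kernel as an integral over the rescaled frequency -/

theorem overCsinh_ofReal (x : ℝ) : overCsinh x = (overSinh 1 x : ℂ) := by
  rcases eq_or_ne x 0 with rfl | hx
  · simp [overCsinh_zero, overSinh]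
  · rw [overCsinh_of_ne (by exact_mod_cast hx), overSinh, if_neg hx]; simp

theorem overSinh_one_pos (x : ℝ) : 0 < overSinh 1 x := by
  have := re_overCsinh_pos (u := x) (by simpa using (half_pos pi_pos).le)
  simpa [overCsinh_ofReal] using this

theorem overSinh_eq {t : ℝ} (ht : 0 < t) (l : ℝ) : overSinh t l = overSinh 1 (t * l) / t := by
  rcases eq_or_ne l 0 with rfl | hl
  · simp [overSinh]
  · rw [overSinh, overSinh, if_neg hl, if_neg (mul_ne_zero ht.ne' hl), one_mul]
    field_simp

/-- The integrand of the modified heat kernel, up to a power of `t`, after rescaling the frequency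
by `t` and extending it to complex frequencies. -/
noncomputable def kernelIntegrand (a t r w : ℝ) (u : ℂ) : ℂ :=
  overCsinh u ^ (a : ℂ) * Complex.exp (-(overCsinh u *
    (4 * w * Complex.I * Complex.sinh u + r * Complex.cosh u) / (4 * t)))

theorem differentiableAt_kernelIntegrand (a t r w : ℝ) {u : ℂ} (hu : |u.im| ≤ π / 2) :
    DifferentiableAt ℂ (kernelIntegrand a t r w) u := by
  have h1 := differentiableAt_overCsinh hu
  have h2 : overCsinh u ∈ Complex.slitPlane := Or.inl (re_overCsinh_pos hu)
  refine (h1.cpow_const h2).mul (DifferentiableAt.cexp (DifferentiableAt.neg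
    (DifferentiableAt.div_const (h1.mul ?_) _)))
  exact ((Complex.differentiable_sinh u).const_mul _).add
    ((Complex.differentiable_cosh u).const_mul _)

theorem norm_overCsinh_cpow_le {a : ℝ} (ha : 0 ≤ a) {u : ℂ} (hu : |u.im| ≤ π / 2) :
    ‖overCsinh u ^ (a : ℂ)‖ ≤ 12 ^ a * Real.exp (-(a / 2 * |u.re|)) := by
  rw [Complex.norm_cpow_real]
  refine (rpow_le_rpow (norm_nonneg _) (norm_overCsinh_le hu) ha).trans_eq ?_
  rw [mul_rpow (by norm_num) (Real.exp_pos _).le, ← Real.exp_mul]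
  congr 2; ring

/-- Since `(u / sinh u) * sinh u = u`, the `w` term of the exponent is linear in `u` and contributes
exactly `w Im u / t` to the real part; the `r` term only helps. -/
theorem norm_kernelIntegrand_le {a t r : ℝ} (ha : 0 ≤ a) (ht : 0 < t) (hr : 0 ≤ r) (w : ℝ) {u : ℂ}
    (hu : |u.im| ≤ π / 2) : ‖kernelIntegrand a t r w u‖ ≤
      12 ^ a * Real.exp (w * u.im / t) * Real.exp (-(a / 2 * |u.re|)) := by
  have e : overCsinh u * (4 * w * Complex.I * Complex.sinh u + r * Complex.cosh u) / (4 * t) =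
      ((1 / (4 * t) : ℝ) : ℂ) * (((4 * w : ℝ) : ℂ) * (Complex.I * u) +
        (r : ℂ) * (overCsinh u * Complex.cosh u)) := by
    conv_rhs => rw [← overCsinh_mul_sinh hu]
    have : (t : ℂ) ≠ 0 := by exact_mod_cast ht.ne'
    push_cast
    rw [overCsinh_mul_sinh hu]
    field_simp
    linear_combination (4 * w * Complex.I) * overCsinh_mul_sinh hu
  have h : (-(overCsinh u * (4 * w * Complex.I * Complex.sinh u + r * Complex.cosh u) /
      (4 * t))).re ≤ w * u.im / t := by
    rw [e, Complex.neg_re, Complex.re_ofReal_mul, Complex.add_re, Complex.re_ofReal_mul,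
      Complex.re_ofReal_mul, Complex.I_mul_re]
    have h1 := mul_nonneg hr (re_overCsinh_mul_cosh_nonneg hu)
    have h2 : 0 ≤ 1 / (4 * t) := by positivity
    have h3 := mul_nonneg h2 h1
    have h4 : w * u.im / t = 1 / (4 * t) * (4 * w * u.im) := by field_simp
    rw [h4]; linarith
  rw [kernelIntegrand, norm_mul, Complex.norm_exp, mul_right_comm (12 ^ a)]
  exact mul_le_mul (norm_overCsinh_cpow_le ha hu) (Real.exp_le_exp.2 h) (Real.exp_pos _).le
    (by positivity)

theorem norm_kernelIntegrand_le_uniform {a t r : ℝ} (ha : 0 ≤ a) (ht : 0 < t) (hr : 0 ≤ r) (w : ℝ)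
    (u : ℂ) (hu : |u.im| ≤ π / 2) : ‖kernelIntegrand a t r w u‖ ≤
      12 ^ a * Real.exp (|w| * (π / 2) / t) * Real.exp (-(a / 2 * |u.re|)) := by
  refine (norm_kernelIntegrand_le ha ht hr w hu).trans ?_
  have : w * u.im ≤ |w| * (π / 2) := (le_abs_self _).trans (by rw [abs_mul]; gcongr)
  gcongr

theorem integrable_kernelIntegrand {a t r : ℝ} (ha : 0 < a) (ht : 0 < t) (hr : 0 ≤ r) (w : ℝ)
    {y : ℝ} (hy : |y| ≤ π / 2) :
    Integrable fun x : ℝ => kernelIntegrand a t r w (x + y * Complex.I) :=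
  integrable_horizontal (half_pos ha) hy (fun _ hu => differentiableAt_kernelIntegrand a t r w hu)
    (norm_kernelIntegrand_le_uniform ha.le ht hr w)

theorem integral_kernelIntegrand_eq {a t r : ℝ} (ha : 0 < a) (ht : 0 < t) (hr : 0 ≤ r) (w : ℝ)
    {y : ℝ} (hy : |y| ≤ π / 2) :
    ∫ x : ℝ, kernelIntegrand a t r w x = ∫ x : ℝ, kernelIntegrand a t r w (x + y * Complex.I) :=
  integral_horizontal_eq (half_pos ha) hy
    (fun _ hu => differentiableAt_kernelIntegrand a t r w hu)
    (norm_kernelIntegrand_le_uniform ha.le ht hr w)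

/-- The phase is rewritten through `tλ = (u / sinh u) * sinh u` at `u = tλ`, so that oscillation and
Gaussian share the factor `u / sinh u`. -/
theorem cexp_mul_modifiedHeatKernelFT {n : ℕ} (s : ℝ) {t : ℝ} (ht : 0 < t) (w l : ℝ)
    (z : EuclideanSpace ℂ (Fin n)) :
    Complex.exp (-(Complex.I * (l : ℂ) * (w : ℂ))) * (modifiedHeatKernelFT s t l z : ℂ) =
      (((4 * π * t) ^ n)⁻¹ : ℝ) * kernelIntegrand (n + s + 1) t (‖z‖ ^ 2) w (t * l : ℝ) := by
  have hS := overSinh_one_pos (t * l)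
  have hsinh : overSinh 1 (t * l) * sinh (t * l) = t * l := by
    have := overCsinh_mul_sinh (u := (t * l : ℝ)) (by simpa using (half_pos pi_pos).le)
    rw [overCsinh_ofReal, ← Complex.ofReal_sinh] at this
    exact_mod_cast this
  have e1 : modifiedHeatKernelFT s t l z = ((4 * π * t) ^ n)⁻¹ *
      (overSinh 1 (t * l) ^ ((n : ℝ) + s + 1) *
        Real.exp (-(overSinh 1 (t * l) * cosh (t * l) * ‖z‖ ^ 2 / (4 * t)))) := by
    rw [modifiedHeatKernelFT, heatKernelFT, overSinh_eq ht, mul_div_cancel₀ _ ht.ne', add_assoc (n : ℝ),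
      rpow_add hS n, rpow_natCast, div_pow]
    have : -(1 / 4) * (overSinh 1 (t * l) / t * cosh (t * l)) * ‖z‖ ^ 2 =
      -(overSinh 1 (t * l) * cosh (t * l) * ‖z‖ ^ 2 / (4 * t)) := by field_simp
    rw [this, mul_pow (4 * π) t n]
    field_simp
  have e2 : kernelIntegrand (n + s + 1) t (‖z‖ ^ 2) w (t * l : ℝ) =
      ((overSinh 1 (t * l) ^ ((n : ℝ) + s + 1) : ℝ) : ℂ) *
        (Complex.exp (-(Complex.I * (l : ℂ) * (w : ℂ))) *
        ((Real.exp (-(overSinh 1 (t * l) * cosh (t * l) * ‖z‖ ^ 2 / (4 * t))) : ℝ) : ℂ)) := by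
    rw [kernelIntegrand, overCsinh_ofReal, Complex.ofReal_cpow hS.le, Complex.ofReal_exp,
      ← Complex.exp_add]
    congr 2
    have ht' : (t : ℂ) ≠ 0 := by exact_mod_cast ht.ne'
    have hs' : (overSinh 1 (t * l) : ℂ) * Complex.sinh ((t * l : ℝ) : ℂ) = t * l := by
      rw [← Complex.ofReal_sinh]; exact_mod_cast hsinh
    push_cast at hs' ⊢
    field_simp
    linear_combination (-4 * w * Complex.I) * hs'
  rw [e1, e2]; push_cast; ring

theorem modifiedHeatKernel_eq {n : ℕ} (s : ℝ) {t : ℝ} (ht : 0 < t) (w : ℝ)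
    (z : EuclideanSpace ℂ (Fin n)) :
    modifiedHeatKernel s t ((z, w) : HeisenbergSpace n) =
      ((2 * π * t * (4 * π * t) ^ n)⁻¹ : ℝ) *
        ∫ u : ℝ, kernelIntegrand (n + s + 1) t (‖z‖ ^ 2) w u := by
  simp only [modifiedHeatKernel, cexp_mul_modifiedHeatKernelFT s ht]
  rw [integral_const_mul, Measure.integral_comp_mul_left
    (fun u : ℝ => kernelIntegrand (n + s + 1) t (‖z‖ ^ 2) w u) t, abs_of_pos (inv_pos.2 ht),
    Complex.real_smul]
  push_cast
  rw [mul_inv, mul_inv]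
  ring

/-! ### Decay in the central variable and Fourier inversion -/

theorem norm_modifiedHeatKernel_le {n : ℕ} {s t : ℝ} (hs : 0 < s) (ht : 0 < t)
    (z : EuclideanSpace ℂ (Fin n)) :
    ∃ C : ℝ, ∀ w : ℝ, ‖modifiedHeatKernel s t ((z, w) : HeisenbergSpace n)‖ ≤
      C * Real.exp (-(π / (2 * t) * |w|)) := by
  have ha : 0 < (n : ℝ) + s + 1 := by positivity
  refine ⟨|(2 * π * t * (4 * π * t) ^ n)⁻¹| *
    ∫ x : ℝ, 12 ^ ((n : ℝ) + s + 1) * Real.exp (-(((n : ℝ) + s + 1) / 2 * |x|)), fun w => ?_⟩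
  -- The edge of the strip on which `exp (w y / t)` is smallest.
  obtain ⟨y, hy, hwy⟩ : ∃ y : ℝ, |y| ≤ π / 2 ∧ w * y = -(|w| * (π / 2)) := by
    have hp := half_pos pi_pos
    rcases le_total 0 w with h | h
    · exact ⟨-(π / 2), by rw [abs_neg, abs_of_pos hp], by rw [abs_of_nonneg h]; ring⟩
    · exact ⟨π / 2, by rw [abs_of_pos hp], by rw [abs_of_nonpos h]; ring⟩
  rw [modifiedHeatKernel_eq s ht, integral_kernelIntegrand_eq ha ht (by positivity) w hy, norm_mul,
    Complex.norm_real, Real.norm_eq_abs]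
  refine (mul_le_mul_of_nonneg_left ?_ (abs_nonneg _)).trans_eq (mul_assoc _ _ _).symm
  rw [← integral_mul_const]
  refine norm_integral_le_of_norm_le
    (((integrable_exp_neg_mul_abs (half_pos ha)).const_mul _).mul_const _)
    (Eventually.of_forall fun x => ?_)
  refine (norm_kernelIntegrand_le ha.le ht (by positivity) w (by simpa using hy)).trans_eq ?_
  have : w * y / t = -(π / (2 * t) * |w|) := by rw [hwy]; field_simp
  simp only [Complex.add_im, Complex.ofReal_im, Complex.mul_im, Complex.ofReal_re, Complex.I_im,
    mul_one, Complex.I_re, mul_zero, add_zero, zero_add, Complex.add_re, Complex.mul_re, sub_self,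
    this]
  ring

open FourierTransform in
theorem modifiedHeatKernel_fourier_inversion {n : ℕ} {s t : ℝ} (hs : 0 < s) (ht : 0 < t)
    (z : EuclideanSpace ℂ (Fin n)) :
    Continuous (fun w : ℝ => modifiedHeatKernel s t ((z, w) : HeisenbergSpace n)) ∧
      Integrable (fun w : ℝ => modifiedHeatKernel s t ((z, w) : HeisenbergSpace n)) ∧
      ∀ l : ℝ,
        ∫ w : ℝ, modifiedHeatKernel s t ((z, w) : HeisenbergSpace n) *
            Complex.exp (Complex.I * (l : ℂ) * (w : ℂ)) =
          (modifiedHeatKernelFT s t l z : ℂ) := by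
  have ha : 0 < (n : ℝ) + s + 1 := by positivity
  have hp : (0 : ℝ) < 2 * π := by positivity
  have hpc : (2 * π : ℂ) ≠ 0 := by exact_mod_cast hp.ne'
  set f : ℝ → ℂ := fun l => (modifiedHeatKernelFT s t l z : ℂ) with hf
  have hfeq : f = fun l : ℝ => (((4 * π * t) ^ n)⁻¹ : ℝ) *
      kernelIntegrand (n + s + 1) t (‖z‖ ^ 2) 0 (t * l : ℝ) := by
    ext l
    have := cexp_mul_modifiedHeatKernelFT s ht 0 l z
    simpa using this
  have hfc : Continuous f := by
    rw [hfeq]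
    refine continuous_const.mul (continuous_iff_continuousAt.2 fun l => ?_)
    exact ContinuousAt.comp (f := fun l : ℝ => ((t * l : ℝ) : ℂ))
      (differentiableAt_kernelIntegrand _ _ _ _ (by simpa using (half_pos pi_pos).le)).continuousAt
      (by fun_prop)
  have hfi : Integrable f := by
    rw [hfeq]
    have := integrable_kernelIntegrand ha ht (sq_nonneg ‖z‖) 0 (y := 0)
      (by simpa using (half_pos pi_pos).le)
    simp only [Complex.ofReal_zero, zero_mul, add_zero] at this
    exact (this.comp_mul_left' ht.ne').const_mul _
  -- The phase of `𝓕` is `exp (-2πi l ξ)`, hence the frequency `w / (2π)`.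
  have hK : ∀ w : ℝ, modifiedHeatKernel s t ((z, w) : HeisenbergSpace n) =
      1 / (2 * (π : ℂ)) * 𝓕 f (w / (2 * π)) := by
    intro w
    rw [Real.fourier_real_eq_integral_exp_smul]
    simp only [modifiedHeatKernel, hf]
    congr 2
    ext l
    rw [smul_eq_mul]
    congr 2
    push_cast
    field_simp
  have hFc : Continuous (𝓕 f) :=
    VectorFourier.fourierIntegral_continuous Real.continuous_fourierChar
      (by exact continuous_inner) hfi
  have hKc : Continuous (fun w : ℝ => modifiedHeatKernel s t ((z, w) : HeisenbergSpace n)) := by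
    simp only [hK]
    exact continuous_const.mul (hFc.comp (by fun_prop))
  have hKi : Integrable (fun w : ℝ => modifiedHeatKernel s t ((z, w) : HeisenbergSpace n)) := by
    obtain ⟨C, hC⟩ := norm_modifiedHeatKernel_le hs ht z
    exact ((integrable_exp_neg_mul_abs (by positivity)).const_mul C).mono'
      hKc.aestronglyMeasurable (Eventually.of_forall hC)
  have hF : 𝓕 f = fun ξ : ℝ =>
      2 * π * modifiedHeatKernel s t ((z, 2 * π * ξ) : HeisenbergSpace n) := by
    ext ξ
    rw [hK, mul_div_cancel_left₀ _ hp.ne']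
    field_simp
  have hFi : Integrable (𝓕 f) := by
    rw [hF]
    exact (hKi.comp_mul_left' hp.ne').const_mul _
  refine ⟨hKc, hKi, fun l => ?_⟩
  have hinv := congrFun (hfc.fourierInv_fourier_eq hfi hFi) l
  rw [← show f l = (modifiedHeatKernelFT s t l z : ℂ) from rfl, ← hinv, Real.fourierInv_eq']
  have hsub := Measure.integral_comp_mul_left (fun w : ℝ =>
    modifiedHeatKernel s t ((z, w) : HeisenbergSpace n) *
      Complex.exp (Complex.I * (l : ℂ) * (w : ℂ))) (2 * π)
  rw [abs_of_pos (inv_pos.2 hp), eq_inv_smul_iff₀ hp.ne', Complex.real_smul,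
    ← integral_const_mul] at hsub
  rw [← hsub]
  congr 1
  ext ξ
  rw [hF, smul_eq_mul]
  have : ((2 * π * inner ℝ ξ l : ℝ) : ℂ) * Complex.I = Complex.I * l * ((2 * π * ξ : ℝ) : ℂ) := by
    simp
    ring
  rw [this]
  push_cast
  ring

/-! ### The rotated contour and the closed formula -/

theorem Complex.ofReal_mul_cpow {ρ : ℝ} (hρ : 0 < ρ) {x : ℂ} (hx : x ≠ 0) (b : ℂ) :
    ((ρ : ℂ) * x) ^ b = (ρ : ℂ) ^ b * x ^ b := by
  have hρ' : (ρ : ℂ) ≠ 0 := by exact_mod_cast hρ.ne'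
  rw [Complex.cpow_def_of_ne_zero (mul_ne_zero hρ' hx), Complex.cpow_def_of_ne_zero hρ',
    Complex.cpow_def_of_ne_zero hx, Complex.log_ofReal_mul hρ hx, Complex.ofReal_log hρ.le, add_mul,
    Complex.exp_add]

/-- The combination of hyperbolic functions in the kernel is a rotated hyperbolic cosine. -/
theorem kernelIntegrand_sub_arg (a t r w : ℝ) (x : ℝ) :
    kernelIntegrand a t r w (x + (-Complex.arg ⟨r, 4 * w⟩ : ℝ) * Complex.I) =
      overCsinh (x + (-Complex.arg ⟨r, 4 * w⟩ : ℝ) * Complex.I) ^ (a : ℂ) *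
        Complex.exp (-(overCsinh (x + (-Complex.arg ⟨r, 4 * w⟩ : ℝ) * Complex.I) *
          ((‖(⟨r, 4 * w⟩ : ℂ)‖ * cosh x / 4 : ℝ) : ℂ) / t)) := by
  set ζ : ℂ := ⟨r, 4 * w⟩ with hζ
  set u : ℂ := x + (-Complex.arg ζ : ℝ) * Complex.I with hu
  have hr : (r : ℂ) = ‖ζ‖ * Complex.cos (Complex.arg ζ) := by
    have : ‖ζ‖ * cos (Complex.arg ζ) = r := Complex.norm_mul_cos_arg ζ
    rw [← this]; push_cast; rfl
  have hw : (4 * w : ℂ) = ‖ζ‖ * Complex.sin (Complex.arg ζ) := by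
    have : ‖ζ‖ * sin (Complex.arg ζ) = 4 * w := Complex.norm_mul_sin_arg ζ
    rw [show (4 * w : ℂ) = ((4 * w : ℝ) : ℂ) by push_cast; rfl, ← this]; push_cast; rfl
  have hx : (x : ℂ) = u + Complex.arg ζ * Complex.I := by rw [hu]; push_cast; ring
  clear_value u
  have key : 4 * w * Complex.I * Complex.sinh u + r * Complex.cosh u =
      ((‖ζ‖ * cosh x : ℝ) : ℂ) := by
    rw [Complex.ofReal_mul, Complex.ofReal_cosh, hx, Complex.cosh_add, Complex.cosh_mul_I,
      Complex.sinh_mul_I, hr, hw]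
    ring
  rw [kernelIntegrand, key]
  congr 3
  push_cast
  ring

/-- The integral of the exponential yields `Γ(a) (S ρ) ^ (-a)`, so the complex `S` disappears: this
is why the exponent `s + 1` in the modified kernel leads to a closed form. -/
theorem integral_rpow_mul_cpow_mul_cexp {a : ℝ} (ha : 0 < a) {S : ℂ} (hS : 0 < S.re) {ρ : ℝ}
    (hρ : 0 < ρ) :
    ∫ t : ℝ in Ioi 0, ((t ^ (-a - 1) : ℝ) : ℂ) * (S ^ (a : ℂ) * Complex.exp (-(S * ρ / t))) =
      ((Real.Gamma a * ρ ^ (-a) : ℝ) : ℂ) := by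
  have hS0 : S ≠ 0 := fun h => by simp [h] at hS
  have hB : 0 < (S * ρ).re := by
    rw [Complex.re_mul_ofReal]; positivity
  simp only [mul_left_comm _ (S ^ (a : ℂ))]
  have harg : S.arg ≠ π := fun h => by
    have := (Complex.arg_eq_pi_iff.1 h).1
    linarith
  rw [integral_const_mul, integral_rpow_mul_cexp_neg_div_Ioi ha hB, mul_inv, mul_comm S⁻¹,
    ← Complex.ofReal_inv, Complex.ofReal_mul_cpow (inv_pos.2 hρ) (inv_ne_zero hS0),
    Complex.inv_cpow _ _ harg, ← Complex.ofReal_cpow (inv_pos.2 hρ).le, inv_rpow hρ.le,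
    ← rpow_neg hρ.le]
  have : S ^ (a : ℂ) ≠ 0 := by simp [Complex.cpow_eq_zero_iff, hS0]
  push_cast
  field_simp

/-- This is what Fubini needs. The lower bound `c` on `Re S * cosh x`, uniform on the line,
dominates the integrand by a product of a function of `t` and `exp (-a|x|/2)`, up to constants. -/
theorem integrable_rpow_mul_cpow_mul_cexp {a y R : ℝ} (ha : 0 < a) (hy : |y| ≤ π / 2)
    (hR : 0 < R) :
    Integrable (fun p : ℝ × ℝ => ((p.1 ^ (-a - 1) : ℝ) : ℂ) *
      (overCsinh (p.2 + y * Complex.I) ^ (a : ℂ) *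
        Complex.exp (-(overCsinh (p.2 + y * Complex.I) * ((R * cosh p.2 / 4 : ℝ) : ℂ) / p.1))))
      ((volume.restrict (Ioi 0)).prod volume) := by
  obtain ⟨c, hc, hcS⟩ := exists_pos_le_re_overCsinh_mul_cosh hy
  have him : ∀ x : ℝ, |((x : ℂ) + y * Complex.I).im| ≤ π / 2 := fun x => by simpa using hy
  have hSc : Continuous fun x : ℝ => overCsinh (x + y * Complex.I) :=
    continuous_iff_continuousAt.2 fun x =>
      ContinuousAt.comp (f := fun x : ℝ => (x : ℂ) + y * Complex.I)
        (differentiableAt_overCsinh (him x)).continuousAt (by fun_prop)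
  have hSm : Measurable fun p : ℝ × ℝ => overCsinh (p.2 + y * Complex.I) :=
    hSc.measurable.comp measurable_snd
  have hbound := (integrableOn_rpow_mul_exp_neg_div_Ioi (b := R * c / 4) ha (by positivity)).mul_prod
    ((integrable_exp_neg_mul_abs (half_pos ha)).const_mul (12 ^ a))
  refine Integrable.mono' hbound ?_ ?_
  · refine Measurable.aestronglyMeasurable ?_
    have h1 : Measurable fun p : ℝ × ℝ => cosh p.2 := continuous_cosh.measurable.comp measurable_snd
    fun_prop
  · have hpos : ∀ᵐ p : ℝ × ℝ ∂((volume.restrict (Ioi 0)).prod volume), 0 < p.1 :=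
      Measure.quasiMeasurePreserving_fst.ae (ae_restrict_mem measurableSet_Ioi)
    filter_upwards [hpos] with p hp
    have h1 := norm_overCsinh_cpow_le ha.le (him p.2)
    have h2 : ‖Complex.exp (-(overCsinh (p.2 + y * Complex.I) * ((R * cosh p.2 / 4 : ℝ) : ℂ) /
        p.1))‖ ≤ Real.exp (-(R * c / 4 / p.1)) := by
      rw [Complex.norm_exp, Complex.neg_re, Complex.div_ofReal_re, Complex.re_mul_ofReal]
      refine Real.exp_le_exp.2 (neg_le_neg ?_)
      gcongr
      nlinarith [hcS p.2]
    simp only [Complex.add_re, Complex.ofReal_re, Complex.mul_re, Complex.I_re, mul_zero,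
      Complex.ofReal_im, Complex.I_im, mul_one, sub_self, add_zero] at h1
    rw [norm_mul, norm_mul, Complex.norm_real, Real.norm_eq_abs,
      abs_of_nonneg (rpow_nonneg hp.le _), mul_assoc]
    refine mul_le_mul_of_nonneg_left ?_ (rpow_nonneg hp.le _)
    rw [mul_comm (Real.exp _)]
    exact mul_le_mul h1 h2 (norm_nonneg _) (by positivity)

theorem fractionalKernel_formula {n : ℕ} {s : ℝ} (hs : 0 < s) (z : EuclideanSpace ℂ (Fin n))
    (w : ℝ) (hzw : (z, w) ≠ (0, 0)) :
    IntegrableOn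
        (fun t : ℝ => modifiedHeatKernel s t ((z, w) : HeisenbergSpace n) *
          ((t ^ (-s - 1) : ℝ) : ℂ)) (Ioi 0) ∧
      fractionalKernel s ((z, w) : HeisenbergSpace n) =
        (((2 : ℝ) ^ ((n : ℝ) + 1 + 3 * s) * π ^ (-(n : ℝ) - 1) *
            Real.Gamma (((n : ℝ) + s + 1) / 2) ^ 2 *
            homogeneousNorm ((z, w) : HeisenbergSpace n) ^ (-homogeneousDim n - 2 * s) : ℝ) :
          ℂ) := by
  set a : ℝ := (n : ℝ) + s + 1 with ha_def
  have ha : 0 < a := by positivity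
  set ζ : ℂ := ⟨‖z‖ ^ 2, 4 * w⟩ with hζ
  have hζ0 : ζ ≠ 0 := fun h => by
    have h1 : ‖z‖ ^ 2 = 0 := congrArg Complex.re h
    have h2 : 4 * w = 0 := congrArg Complex.im h
    exact hzw (Prod.ext (by simpa using h1) (by simpa using h2))
  have hR : 0 < ‖ζ‖ := norm_pos_iff.2 hζ0
  -- Equality occurs when `z = 0`, so the shift may reach the edge and the strip must be closed.
  have harg : |(-Complex.arg ζ)| ≤ π / 2 := by
    rw [abs_neg, Complex.abs_arg_le_pi_div_two_iff]
    exact sq_nonneg ‖z‖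
  set y : ℝ := -Complex.arg ζ with hy
  set F : ℝ → ℝ → ℂ := fun t x => ((t ^ (-a - 1) : ℝ) : ℂ) *
      (overCsinh (x + y * Complex.I) ^ (a : ℂ) *
        Complex.exp (-(overCsinh (x + y * Complex.I) * ((‖ζ‖ * cosh x / 4 : ℝ) : ℂ) / t))) with hF
  have hFint : Integrable (Function.uncurry F) ((volume.restrict (Ioi 0)).prod volume) :=
    integrable_rpow_mul_cpow_mul_cexp ha harg hR
  have hK : EqOn (fun t : ℝ => ((2 * π * (4 * π) ^ n)⁻¹ : ℝ) * ∫ x : ℝ, F t x)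
      (fun t : ℝ => modifiedHeatKernel s t ((z, w) : HeisenbergSpace n) *
          ((t ^ (-s - 1) : ℝ) : ℂ)) (Ioi 0) := by
    intro t ht
    have ht : 0 < t := ht
    simp only [hF]
    rw [integral_const_mul, modifiedHeatKernel_eq s ht,
      integral_kernelIntegrand_eq ha ht (sq_nonneg ‖z‖) w harg]
    simp only [hy, hζ, kernelIntegrand_sub_arg]
    -- The prefactor `t ^ (-n-1)` of the kernel and the weight `t ^ (-s-1)` combine to exactly the
    -- power required by the Laplace integral.
    have e : t ^ (-a - 1) = (t ^ (n + 1))⁻¹ * t ^ (-s - 1) := by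
      rw [← rpow_natCast, ← rpow_neg ht.le, ← rpow_add ht]
      congr 1; push_cast; ring
    have e' : (2 * π * t * (4 * π * t) ^ n)⁻¹ = (2 * π * (4 * π) ^ n)⁻¹ * (t ^ (n + 1))⁻¹ := by
      rw [← mul_inv]; congr 1; ring
    rw [e, e']
    push_cast
    ring
  have hint : ∫ t : ℝ in Ioi 0, ∫ x : ℝ, F t x =
      ((Real.Gamma a * (‖ζ‖ / 4) ^ (-a) * ∫ x : ℝ, cosh x ^ (-a) : ℝ) : ℂ) := by
    rw [integral_integral_swap hFint]
    have : ∀ x : ℝ, ∫ t : ℝ in Ioi 0, F t x =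
        ((Real.Gamma a * (‖ζ‖ / 4) ^ (-a) * cosh x ^ (-a) : ℝ) : ℂ) := fun x => by
      simp only [hF]
      rw [integral_rpow_mul_cpow_mul_cexp ha (re_overCsinh_pos (by simpa using harg))
        (by have := cosh_pos x; positivity), mul_div_right_comm,
        mul_rpow (by positivity) (cosh_pos x).le, mul_assoc]
    simp only [this]
    rw [integral_complex_ofReal, integral_const_mul]
  refine ⟨(hFint.integral_prod_left.const_mul _).congr
    ((ae_restrict_iff' measurableSet_Ioi).2 (Eventually.of_forall hK)), ?_⟩
  rw [fractionalKernel, ← setIntegral_congr_fun measurableSet_Ioi hK, integral_const_mul, hint,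
    ← Complex.ofReal_mul, Complex.ofReal_inj, integral_cosh_rpow_neg ha]
  -- The homogeneous norm is `‖ζ‖ ^ (1/2)` and `Q + 2s = 2a`.
  have hnorm : homogeneousNorm ((z, w) : HeisenbergSpace n) ^ (-homogeneousDim n - 2 * s) =
      ‖ζ‖ ^ (-a) := by
    have h1 : ‖z‖ ^ 4 + 16 * w ^ 2 = ‖ζ‖ ^ (2 : ℝ) := by
      rw [rpow_two, ← Complex.normSq_eq_norm_sq, Complex.normSq_apply, hζ]
      ring
    rw [homogeneousNorm, h1, ← rpow_mul hR.le, ← rpow_mul hR.le, homogeneousDim, ha_def]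
    congr 1; ring
  rw [hnorm, div_rpow hR.le (by norm_num)]
  have hG : Real.Gamma a ≠ 0 := (Real.Gamma_pos_of_pos ha).ne'
  have h4 : (4 : ℝ) ^ (-a) = 2 ^ (-2 * a) := by
    rw [show (4 : ℝ) = 2 ^ (2 : ℝ) by norm_num, ← rpow_mul two_pos.le]; ring_nf
  have h4n : (2 * π * (4 * π) ^ n)⁻¹ = (2 : ℝ) ^ (-(2 * n + 1) : ℝ) * π ^ (-(n : ℝ) - 1) := by
    rw [mul_pow, show (2 * π * (4 ^ n * π ^ n)) = (2 * 4 ^ n) * (π ^ n * π) by ring, mul_inv,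
      ← pow_succ, show (2 * 4 ^ n : ℝ) = 2 ^ (2 * n + 1) by rw [pow_succ, pow_mul]; norm_num; ring,
      ← rpow_natCast, ← rpow_natCast, ← rpow_neg two_pos.le, ← rpow_neg pi_pos.le]
    congr 2 <;> push_cast <;> ring
  have h2 : (2 : ℝ) ^ ((n : ℝ) + 1 + 3 * s) =
      2 ^ (-(2 * n + 1) : ℝ) * (2 ^ (-2 * a))⁻¹ * 2 ^ (a - 1) := by
    rw [← rpow_neg two_pos.le, ← rpow_add two_pos, ← rpow_add two_pos, ha_def]
    congr 1; ring
  rw [h4, h4n, h2]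
  field_simp

theorem mainTheorem11 (n : ℕ) (hn : 1 ≤ n) (s : ℝ) (hs0 : 0 < s) (hs1 : s < 1) :
    (∀ (t : ℝ), 0 < t → ∀ (z : EuclideanSpace ℂ (Fin n)),
      Continuous (fun w : ℝ => modifiedHeatKernel s t ((z, w) : HeisenbergSpace n)) ∧
      Integrable (fun w : ℝ => modifiedHeatKernel s t ((z, w) : HeisenbergSpace n)) ∧
      ∀ l : ℝ,
        ∫ w : ℝ, modifiedHeatKernel s t ((z, w) : HeisenbergSpace n) *
            Complex.exp (Complex.I * (l : ℂ) * (w : ℂ)) =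
          (modifiedHeatKernelFT s t l z : ℂ)) ∧
    ∀ (z : EuclideanSpace ℂ (Fin n)) (w : ℝ), (z, w) ≠ (0, 0) →
      IntegrableOn
        (fun t : ℝ => modifiedHeatKernel s t ((z, w) : HeisenbergSpace n) *
          ((t ^ (-s - 1) : ℝ) : ℂ)) (Ioi 0) ∧
      fractionalKernel s ((z, w) : HeisenbergSpace n) =
        (((2 : ℝ) ^ ((n : ℝ) + 1 + 3 * s) * π ^ (-(n : ℝ) - 1) *
            Real.Gamma (((n : ℝ) + s + 1) / 2) ^ 2 *
            homogeneousNorm ((z, w) : HeisenbergSpace n) ^ (-homogeneousDim n - 2 * s) : ℝ) : ℂ) :=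
  ⟨fun _ ht z => modifiedHeatKernel_fourier_inversion hs0 ht z,
    fun z w hzw => fractionalKernel_formula hs0 z w hzw⟩
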